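/- Let $K \ge 3$ be an odd integer, and let $$D^{(K)} = \{x = (x_0,\ldots,x_{K-1}) \in [0,1]^K : x_0 + \cdots + x_{K-1} = 1\}$$ be the standard $(K-1)$-simplex. For $x \in D^{(K)}$ put $$f_3^{(K)}(x) = \sum_{\substack{0 \le i_0 < i_1 < i_2 < K\\ i_1 - i_0,\ i_2 - i_1 \text{ odd}}} x_{i_0} x_{i_1} x_{i_2}, \qquad f_5^{(K)}(x) = \sum_{\substack{0 \le i_0 < i_1 < i_2 < i_3 < i_4 < K\\ i_1 - i_0,\ i_2 - i_1,\ i_3 - i_2,\ i_4 - i_3 \text{ odd}}} x_{i_0} x_{i_1} x_{i_2} x_{i_3} x_{i_4},$$ and $f^{(K)}(x) = f_3^{(K)}(x) - 24\, f_5^{(K)}(x)$. Then $f^{(K)}$ attains a maximum on $D^{(K)}$, and $$\max_{x \in D^{(K)}} f^{(K)}(x) = \frac{1}{27}.$$ -/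

import Mathlib

namespace Herman

/-- The index triples `(i₀, i₁, i₂)` with `0 ≤ i₀ < i₁ < i₂ < K` and `i₁ - i₀`, `i₂ - i₁` odd. -/
def triples (K : ℕ) : Finset (Fin K × Fin K × Fin K) :=
  Finset.univ.filter fun (i₀, i₁, i₂) =>
    (i₀ < i₁ ∧ i₁ < i₂) ∧
      (Odd ((i₁ : ℕ) - (i₀ : ℕ)) ∧ Odd ((i₂ : ℕ) - (i₁ : ℕ)))

/-- The index quintuples `(i₀, i₁, i₂, i₃, i₄)` with `0 ≤ i₀ < i₁ < i₂ < i₃ < i₄ < K` and all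
four differences of consecutive indices odd. -/
def quintuples (K : ℕ) : Finset (Fin K × Fin K × Fin K × Fin K × Fin K) :=
  Finset.univ.filter fun (i₀, i₁, i₂, i₃, i₄) =>
    (i₀ < i₁ ∧ i₁ < i₂ ∧ i₂ < i₃ ∧ i₃ < i₄) ∧
      (Odd ((i₁ : ℕ) - (i₀ : ℕ)) ∧ Odd ((i₂ : ℕ) - (i₁ : ℕ)) ∧
        Odd ((i₃ : ℕ) - (i₂ : ℕ)) ∧ Odd ((i₄ : ℕ) - (i₃ : ℕ)))

/-- The cubic polynomial `f₃` in `K` variables. -/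
def f₃ (K : ℕ) (x : Fin K → ℝ) : ℝ :=
  ∑ i ∈ triples K, x i.1 * x i.2.1 * x i.2.2

/-- The quintic polynomial `f₅` in `K` variables. -/
def f₅ (K : ℕ) (x : Fin K → ℝ) : ℝ :=
  ∑ i ∈ quintuples K, x i.1 * x i.2.1 * x i.2.2.1 * x i.2.2.2.1 * x i.2.2.2.2

/-- The polynomial `f = f₃ - 24 f₅` in `K` variables. -/
def f (K : ℕ) (x : Fin K → ℝ) : ℝ :=
  f₃ K x - 24 * f₅ K x

end Herman

/-! The coefficients `f₃` and `f₅` appear in a product of transfer matrices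
`!![x i * t, 1; 1, 0]`: for odd `K` its determinant is `-1`, and its trace is
`∑ x i * t + f₃ * t ^ 3 + f₅ * t ^ 5 + ⋯`, an odd polynomial which on the simplex has the form
`t * H (t ^ 2)` with `H (0) = 1`. An energy argument for nonnegative weights shows that an
eigenvalue `lam` of modulus `1` occurs only for purely imaginary `t`. Since the trace is then
`lam - lam⁻¹`, the cases `lam = 1` and `lam = I` say that `H = ∏ (1 + a X)` with all `a ≥ 0`, and
that `p - 2` has only real roots, where `p (z) = z * H (-z ^ 2)`.

By Laguerre's inequality a nonconstant polynomial with only real roots has no negative local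
maximum, so a local maximum `z` of `p` between `0` and its first positive zero satisfies
`p (z) ≥ 2`. The critical point equation gives `2 * f₃ * z ^ 2 ≤ 1`, and a Bonferroni inequality
gives `p (z) ≤ z - f₃ * z ^ 3 + f₅ * z ^ 5`. If `f₃ - 27 / 2 * f₅` were larger than `1 / 27`, then
`z ^ 2 ≤ 27 / 2`, and hence `p (z) < z - z ^ 3 / 27 ≤ 2`. -/

namespace Herman

open Polynomial

section Laguerre

/-- The Laguerre expression `(q')² - q q''` of a polynomial `q`. Its positivity expresses that
`log |q|` is strictly concave away from the roots of `q`. -/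
noncomputable def laguerre {R : Type*} [CommRing R] (q : R[X]) : R[X] :=
  derivative q ^ 2 - q * derivative (derivative q)

theorem laguerre_mul {R : Type*} [CommRing R] (p q : R[X]) :
    laguerre (p * q) = p ^ 2 * laguerre q + q ^ 2 * laguerre p := by
  simp only [laguerre, derivative_mul, derivative_add]
  ring

theorem laguerre_C {R : Type*} [CommRing R] (a : R) : laguerre (C a) = 0 := by
  simp [laguerre]

theorem laguerre_X_add_C {R : Type*} [CommRing R] (a : R) : laguerre (X + C a) = 1 := by
  simp [laguerre]

variable {F : Type*} [Field F] [LinearOrder F] [IsStrictOrderedRing F] {q : F[X]}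

theorem eval_laguerre_nonneg (hq : q.Splits) (z : F) : 0 ≤ (laguerre q).eval z := by
  induction hq using Submonoid.closure_induction with
  | mem p hp =>
    rcases hp with ⟨a, rfl⟩ | ⟨a, rfl⟩
    · simp [laguerre_C]
    · simp [laguerre_X_add_C]
  | one => simp [laguerre]
  | mul p q _ _ hp hq =>
    simp only [laguerre_mul, eval_add, eval_mul, eval_pow]
    positivity

theorem eval_laguerre_pos (hq : q.Splits) (hdeg : q.natDegree ≠ 0) {z : F} (hz : q.eval z ≠ 0) :
    0 < (laguerre q).eval z := by
  obtain ⟨r, hr⟩ := hq.exists_eval_eq_zero (mt natDegree_eq_of_degree_eq_some hdeg)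
  obtain ⟨g, rfl⟩ := dvd_iff_isRoot.2 hr
  have hg : g.Splits := splits_X_sub_C_mul_iff.1 hq
  have hgz : g.eval z ≠ 0 := fun h => hz (by rw [eval_mul, h, mul_zero])
  have hlag : laguerre (X - C r) = 1 := by
    rw [sub_eq_add_neg, ← C_neg, laguerre_X_add_C]
  have hpos := eval_laguerre_nonneg hg z
  simp only [laguerre_mul, hlag, eval_add, eval_mul, eval_pow, eval_one]
  positivity

end Laguerre

-- At a negative local maximum, Laguerre's inequality forces `q'' > 0`, so the point is also a
-- local minimum and `q` is locally constant.
theorem eval_nonneg_of_isLocalMax {q : ℝ[X]} (hq : q.Splits) (hdeg : q.natDegree ≠ 0) {z : ℝ}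
    (hmax : IsLocalMax (fun x => q.eval x) z) : 0 ≤ q.eval z := by
  by_contra! hneg
  have hderiv (p : ℝ[X]) : deriv (fun x => p.eval x) = fun x => p.derivative.eval x :=
    funext fun _ => p.deriv
  have hcrit : q.derivative.eval z = 0 := by rw [← q.deriv, hmax.deriv_eq_zero]
  have hsecond : 0 < q.derivative.derivative.eval z := by
    have hlag := eval_laguerre_pos hq hdeg hneg.ne
    simp only [laguerre, eval_sub, eval_pow, hcrit, eval_mul] at hlag
    nlinarith
  have hmin : IsLocalMin (fun x => q.eval x) z :=
    isLocalMin_of_deriv_deriv_pos (by rwa [hderiv, hderiv]) (by rwa [hderiv])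
      q.continuous.continuousAt
  have hconst : (fun x => q.eval x) =ᶠ[nhds z] fun _ => q.eval z := by
    filter_upwards [hmax, hmin] with x hle hge using le_antisymm hle hge
  have hzero := hconst.deriv.deriv_eq
  simp only [hderiv, deriv_const'] at hzero
  exact hsecond.ne' hzero

theorem splits_of_aeval_complex_eq_zero {p : ℝ[X]}
    (h : ∀ z : ℂ, aeval z p = 0 → z.im = 0) : p.Splits := by
  refine Splits.of_splits_map (algebraMap ℝ ℂ) (IsAlgClosed.splits _) fun z hz => ?_
  have hroot : aeval z p = 0 := by
    rw [← eval_map_algebraMap]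
    exact (mem_roots'.1 hz).2
  exact ⟨z.re, Complex.ext rfl (h z hroot).symm⟩

section ProdOneAdd

/-- The polynomial `∏ (1 + a X)` over the members `a` of a multiset, whose coefficients are the
elementary symmetric functions of `a`. It is the normal form of a split polynomial with constant
term `1`. -/
noncomputable def prodOneAdd {R : Type*} [CommSemiring R] (s : Multiset R) : R[X] :=
  (s.map fun a => 1 + C a * X).prod

variable {R : Type*} [CommSemiring R]

theorem prodOneAdd_zero : prodOneAdd (0 : Multiset R) = 1 := rfl

theorem prodOneAdd_cons (a : R) (s : Multiset R) :
    prodOneAdd (a ::ₘ s) = (1 + C a * X) * prodOneAdd s := by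
  simp only [prodOneAdd, Multiset.map_cons, Multiset.prod_cons]

theorem coeff_zero_prodOneAdd (s : Multiset R) : (prodOneAdd s).coeff 0 = 1 := by
  simp [prodOneAdd, coeff_zero_multiset_prod]

theorem coeff_succ_prodOneAdd_cons (a : R) (s : Multiset R) (n : ℕ) :
    (prodOneAdd (a ::ₘ s)).coeff (n + 1) =
      (prodOneAdd s).coeff (n + 1) + a * (prodOneAdd s).coeff n := by
  rw [prodOneAdd_cons, add_mul, one_mul, coeff_add, mul_assoc, coeff_C_mul, coeff_X_mul]

theorem coeff_one_prodOneAdd (s : Multiset R) : (prodOneAdd s).coeff 1 = s.sum := by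
  induction s using Multiset.induction_on with
  | empty => simp [prodOneAdd_zero, coeff_one]
  | cons a s ih =>
    rw [coeff_succ_prodOneAdd_cons, ih, coeff_zero_prodOneAdd, mul_one, Multiset.sum_cons,
      add_comm]

theorem eval_prodOneAdd (s : Multiset R) (w : R) :
    (prodOneAdd s).eval w = (s.map fun a => 1 + a * w).prod := by
  simp [prodOneAdd, eval_multiset_prod, Multiset.map_map]

theorem eq_prodOneAdd_of_splits {F : Type*} [Field F] {H : F[X]} (hH : H.Splits)
    (h0 : H.coeff 0 = 1) : H = prodOneAdd (H.roots.map fun r => -r⁻¹) := by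
  have hfactor : ∀ r ∈ H.roots, X - C r = C (-r) * (1 + C (-r⁻¹) * X) := by
    intro r hr
    have hr0 : r ≠ 0 := by
      rintro rfl
      exact one_ne_zero (h0.symm.trans (coeff_zero_eq_eval_zero H ▸ (mem_roots'.1 hr).2))
    rw [mul_add, ← mul_assoc, ← C_mul, neg_mul_neg, mul_inv_cancel₀ hr0, C_neg, C_1]
    ring
  have hprod : H = C (H.leadingCoeff * (H.roots.map fun r => -r).prod) *
      prodOneAdd (H.roots.map fun r => -r⁻¹) := by
    conv_lhs => rw [hH.eq_prod_roots, Multiset.map_congr rfl hfactor, Multiset.prod_map_mul]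
    simp only [prodOneAdd, Multiset.map_map, Function.comp_def, C_mul, mul_assoc,
      map_multiset_prod]
  have hone : H.leadingCoeff * (H.roots.map fun r => -r).prod = 1 := by
    have hcoeff := congrArg (fun p => p.coeff 0) hprod
    simp only [coeff_C_mul, coeff_zero_prodOneAdd, h0, mul_one] at hcoeff
    exact hcoeff.symm
  rwa [hone, C_1, one_mul] at hprod

theorem exists_eq_prodOneAdd {H : ℝ[X]} (h0 : H.coeff 0 = 1)
    (hroot : ∀ w : ℂ, aeval w H = 0 → w.im = 0 ∧ w.re ≤ 0) :
    ∃ s : Multiset ℝ, (∀ a ∈ s, 0 ≤ a) ∧ H = prodOneAdd s := by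
  have hH : H.Splits := splits_of_aeval_complex_eq_zero fun w hw => (hroot w hw).1
  refine ⟨_, fun a ha => ?_, eq_prodOneAdd_of_splits hH h0⟩
  obtain ⟨r, hr, rfl⟩ := Multiset.mem_map.1 ha
  have hzero : aeval (r : ℂ) H = 0 := by
    rw [← Complex.coe_algebraMap, aeval_algebraMap_apply, coe_aeval_eq_eval,
      (mem_roots'.1 hr).2, map_zero]
  exact neg_nonneg.2 (inv_nonpos.2 (hroot r hzero).2)

section Ordered

variable {F : Type*} [CommRing F] [LinearOrder F] [IsStrictOrderedRing F] {s : Multiset F} {w : F}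

theorem coeff_prodOneAdd_nonneg (hs : ∀ a ∈ s, 0 ≤ a) (n : ℕ) :
    0 ≤ (prodOneAdd s).coeff n := by
  induction s using Multiset.induction_on generalizing n with
  | empty =>
    rw [prodOneAdd_zero, coeff_one]
    split_ifs <;> simp
  | cons a s ih =>
    obtain ⟨ha, hs⟩ := Multiset.forall_mem_cons.1 hs
    cases n with
    | zero => simp [coeff_zero_prodOneAdd]
    | succ n =>
      rw [coeff_succ_prodOneAdd_cons]
      exact add_nonneg (ih hs _) (mul_nonneg ha (ih hs _))

theorem eval_neg_prodOneAdd_nonneg (hs : ∀ a ∈ s, a * w ≤ 1) : 0 ≤ (prodOneAdd s).eval (-w) := by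
  rw [eval_prodOneAdd]
  refine Multiset.prod_nonneg (Multiset.forall_mem_map_iff.2 fun a ha => ?_)
  rw [mul_neg, ← sub_eq_add_neg]
  exact sub_nonneg.2 (hs a ha)

theorem bonferroni_prodOneAdd (hs : ∀ a ∈ s, 0 ≤ a * w ∧ a * w ≤ 1) (n : ℕ) :
    0 ≤ (-1) ^ n * ((prodOneAdd s).eval (-w) -
      ∑ k ∈ Finset.range n, (prodOneAdd s).coeff k * (-w) ^ k) := by
  induction s using Multiset.induction_on generalizing n with
  | empty =>
    cases n with
    | zero => simp [prodOneAdd_zero]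
    | succ n => simp [prodOneAdd_zero, coeff_one]
  | cons a s ih =>
    cases n with
    | zero => simpa using eval_neg_prodOneAdd_nonneg fun b hb => (hs b hb).2
    | succ n =>
      obtain ⟨ha, hs⟩ := Multiset.forall_mem_cons.1 hs
      have hnext := ih hs (n + 1)
      have hmul := mul_nonneg ha.1 (ih hs n)
      simp only [Finset.sum_range_succ' _ n, coeff_zero_prodOneAdd] at hnext ⊢
      have hsum : ∑ k ∈ Finset.range n, (prodOneAdd (a ::ₘ s)).coeff (k + 1) * (-w) ^ (k + 1) =
          ∑ k ∈ Finset.range n, (prodOneAdd s).coeff (k + 1) * (-w) ^ (k + 1) -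
            a * w * ∑ k ∈ Finset.range n, (prodOneAdd s).coeff k * (-w) ^ k := by
        rw [Finset.mul_sum, ← Finset.sum_sub_distrib]
        refine Finset.sum_congr rfl fun k _ => ?_
        rw [coeff_succ_prodOneAdd_cons]
        ring
      rw [hsum, prodOneAdd_cons]
      simp only [eval_add, eval_mul, eval_one, eval_C, eval_X]
      linear_combination hnext + hmul

theorem coeff_one_mul_eval_neg_le_eval_derivative (hw : 0 ≤ w)
    (hs : ∀ a ∈ s, 0 ≤ a ∧ a * w ≤ 1) :
    (prodOneAdd s).coeff 1 * (prodOneAdd s).eval (-w) ≤ (prodOneAdd s).derivative.eval (-w) := by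
  induction s using Multiset.induction_on with
  | empty => simp [prodOneAdd_zero, coeff_one]
  | cons a s ih =>
    have hP := eval_neg_prodOneAdd_nonneg fun b hb => (hs b (Multiset.mem_cons_of_mem hb)).2
    obtain ⟨⟨ha, haw⟩, hs⟩ := Multiset.forall_mem_cons.1 hs
    have hstep := mul_le_mul_of_nonneg_left (ih hs) (sub_nonneg.2 haw)
    have hdrop := mul_nonneg (mul_nonneg ha (mul_nonneg ha hw)) hP
    rw [coeff_succ_prodOneAdd_cons, coeff_zero_prodOneAdd, prodOneAdd_cons]
    simp only [derivative_mul, derivative_add, derivative_one, derivative_C, derivative_X,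
      eval_add, eval_mul, eval_one, eval_C, eval_X, eval_zero]
    linear_combination hstep + hdrop

end Ordered

end ProdOneAdd

section OddPolynomial

/-- The odd polynomial `z H(-z²)` attached to a polynomial `H`. -/
noncomputable def oddLift {R : Type*} [CommRing R] (H : R[X]) : R[X] := X * H.comp (-X ^ 2)

theorem eval_oddLift {R : Type*} [CommRing R] (H : R[X]) (z : R) :
    (oddLift H).eval z = z * H.eval (-z ^ 2) := by
  simp [oddLift]

theorem eval_derivative_oddLift {R : Type*} [CommRing R] (H : R[X]) (z : R) :
    (oddLift H).derivative.eval z =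
      H.eval (-z ^ 2) - 2 * z ^ 2 * H.derivative.eval (-z ^ 2) := by
  simp only [oddLift, derivative_mul, derivative_X, derivative_comp, derivative_neg,
    derivative_X_pow, eval_add, eval_mul, eval_comp, eval_neg, eval_pow, eval_X, eval_C,
    one_mul, Nat.cast_ofNat, Nat.add_one_sub_one, pow_one]
  ring

theorem natDegree_oddLift_sub_C_ne_zero {R : Type*} [CommRing R] {H : R[X]} (hH : H.coeff 0 ≠ 0)
    (c : R) : (oddLift H - C c).natDegree ≠ 0 := by
  have hcoeff : (oddLift H - C c).coeff 1 = H.coeff 0 := by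
    simp [oddLift, coeff_X_mul, coeff_zero_eq_eval_zero]
  intro hdeg
  exact hH (hcoeff.symm.trans (coeff_eq_zero_of_natDegree_lt (by omega)))

theorem exists_pos_max_of_sum_pos {M : Type*} [AddCommMonoid M] [LinearOrder M]
    [IsOrderedAddMonoid M] {s : Multiset M} (hpos : 0 < s.sum) :
    ∃ b ∈ s, 0 < b ∧ ∀ a ∈ s, a ≤ b := by
  have hne : s.toFinset.Nonempty := by
    rw [Multiset.toFinset_nonempty]
    rintro rfl
    exact hpos.ne' Multiset.sum_zero
  obtain ⟨b, hb, hmax⟩ := s.toFinset.exists_max_image id hne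
  simp only [Multiset.mem_toFinset, id] at hb hmax
  refine ⟨b, hb, ?_, hmax⟩
  by_contra! hb0
  exact hpos.not_ge ((Multiset.sum_le_card_nsmul s b hmax).trans (nsmul_nonpos hb0 _))

variable {s : Multiset ℝ}

theorem exists_isLocalMax_oddLift_prodOneAdd (hpos : 0 < s.sum) :
    ∃ z > 0, (∀ a ∈ s, a * z ^ 2 ≤ 1) ∧ 0 < (prodOneAdd s).eval (-z ^ 2) ∧
      IsLocalMax (fun y => (oddLift (prodOneAdd s)).eval y) z := by
  obtain ⟨b, hb, hb0, hmax⟩ := exists_pos_max_of_sum_pos hpos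
  set r := √b⁻¹
  have hr0 : 0 < r := by positivity
  have hr2 : b * r ^ 2 = 1 := by rw [Real.sq_sqrt (by positivity), mul_inv_cancel₀ hb0.ne']
  have hbound : ∀ a ∈ s, ∀ y, 0 ≤ y → y ≤ r → a * y ^ 2 ≤ 1 := fun a ha y hy0 hyr =>
    hr2 ▸ mul_le_mul (hmax a ha) (pow_le_pow_left₀ hy0 hyr 2) (sq_nonneg y) hb0.le
  have hzero : (prodOneAdd s).eval (-r ^ 2) = 0 := by
    rw [eval_prodOneAdd]
    exact Multiset.prod_eq_zero (Multiset.mem_map.2 ⟨b, hb, by linear_combination -hr2⟩)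
  have hhalf : 0 < (prodOneAdd s).eval (-(r / 2) ^ 2) := by
    rw [eval_prodOneAdd]
    refine Multiset.prod_pos (Multiset.forall_mem_map_iff.2 fun a ha => ?_)
    linarith [hbound a ha r hr0.le le_rfl]
  obtain ⟨z, ⟨hz0, hzr⟩, hz⟩ := isCompact_Icc.exists_isMaxOn (Set.nonempty_Icc.2 hr0.le)
    (oddLift (prodOneAdd s)).continuousOn
  have hval : 0 < z * (prodOneAdd s).eval (-z ^ 2) := by
    have hle := hz (show r / 2 ∈ Set.Icc 0 r by constructor <;> linarith)
    simp only [Set.mem_ofPred_eq, eval_oddLift] at hle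
    exact (mul_pos (half_pos hr0) hhalf).trans_le hle
  have hzpos : 0 < z := hz0.lt_of_ne (by rintro rfl; simp at hval)
  have hzlt : z < r := hzr.lt_of_ne (by rintro rfl; simp [hzero] at hval)
  exact ⟨z, hzpos, fun a ha => hbound a ha z hz0 hzr, pos_of_mul_pos_right hval hz0,
    hz.isLocalMax (Icc_mem_nhds hzpos hzlt)⟩

theorem sum_mul_sq_le_half_of_isLocalMax (hs : ∀ a ∈ s, 0 ≤ a) {z : ℝ}
    (hz : ∀ a ∈ s, a * z ^ 2 ≤ 1) (hpos : 0 < (prodOneAdd s).eval (-z ^ 2))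
    (hmax : IsLocalMax (fun y => (oddLift (prodOneAdd s)).eval y) z) :
    s.sum * z ^ 2 ≤ 1 / 2 := by
  have hcrit : (prodOneAdd s).eval (-z ^ 2) -
      2 * z ^ 2 * (prodOneAdd s).derivative.eval (-z ^ 2) = 0 := by
    rw [← eval_derivative_oddLift, ← Polynomial.deriv, hmax.deriv_eq_zero]
  have hlog := coeff_one_mul_eval_neg_le_eval_derivative (sq_nonneg z)
    fun a ha => ⟨hs a ha, hz a ha⟩
  rw [coeff_one_prodOneAdd] at hlog
  have hmul := mul_le_mul_of_nonneg_left hlog (by positivity : 0 ≤ 2 * z ^ 2)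
  refine le_of_mul_le_mul_right ?_ hpos
  linarith

theorem eval_oddLift_prodOneAdd_le {z : ℝ} (hz : 0 ≤ z)
    (hs : ∀ a ∈ s, 0 ≤ a ∧ a * z ^ 2 ≤ 1) :
    (oddLift (prodOneAdd s)).eval z ≤
      z - (prodOneAdd s).coeff 1 * z ^ 3 + (prodOneAdd s).coeff 2 * z ^ 5 := by
  have hbonf := bonferroni_prodOneAdd (w := z ^ 2)
    (fun a ha => ⟨mul_nonneg (hs a ha).1 (sq_nonneg z), (hs a ha).2⟩) 3
  simp only [Finset.sum_range_succ, Finset.sum_range_zero, coeff_zero_prodOneAdd] at hbonf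
  rw [eval_oddLift]
  linear_combination z * hbonf

theorem coeff_one_sub_coeff_two_prodOneAdd_le (hs : ∀ a ∈ s, 0 ≤ a)
    (hsplits : (oddLift (prodOneAdd s) - C 2).Splits) :
    (prodOneAdd s).coeff 1 - 27 / 2 * (prodOneAdd s).coeff 2 ≤ 1 / 27 := by
  by_contra! hlt
  set e₁ := (prodOneAdd s).coeff 1
  set e₂ := (prodOneAdd s).coeff 2
  have he₂ : 0 ≤ e₂ := coeff_prodOneAdd_nonneg hs 2
  have hsum : s.sum = e₁ := (coeff_one_prodOneAdd s).symm
  obtain ⟨z, hz0, hz, hpos, hmax⟩ :=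
    exists_isLocalMax_oddLift_prodOneAdd (s := s) (by linarith)
  have htwo : 2 ≤ (oddLift (prodOneAdd s)).eval z := by
    have hnonneg := eval_nonneg_of_isLocalMax hsplits
      (natDegree_oddLift_sub_C_ne_zero (by simp [coeff_zero_prodOneAdd]) 2) (z := z)
      (by simpa using hmax.sub isLocalMin_const)
    simpa using hnonneg
  have hz2 : z ^ 2 ≤ 27 / 2 := by
    have hhalf := sum_mul_sq_le_half_of_isLocalMax hs hz hpos hmax
    rw [hsum] at hhalf
    nlinarith
  have hupper : 2 ≤ z - (e₁ - 27 / 2 * e₂) * z ^ 3 := by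
    have hle := eval_oddLift_prodOneAdd_le hz0.le fun a ha => ⟨hs a ha, hz a ha⟩
    have hfive : e₂ * z ^ 3 * z ^ 2 ≤ e₂ * z ^ 3 * (27 / 2) := by gcongr
    linarith
  have hcube : 1 / 27 * z ^ 3 < (e₁ - 27 / 2 * e₂) * z ^ 3 := by gcongr
  have hamgm : 0 ≤ (z - 3) ^ 2 * (z + 6) := by positivity
  linarith

end OddPolynomial

theorem coeff_one_sub_coeff_two_le {H : ℝ[X]} (h0 : H.coeff 0 = 1)
    (hroot : ∀ w : ℂ, aeval w H = 0 → w.im = 0 ∧ w.re ≤ 0)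
    (htwo : ∀ z : ℂ, z * aeval (-z ^ 2) H = 2 → z.im = 0) :
    H.coeff 1 - 27 / 2 * H.coeff 2 ≤ 1 / 27 := by
  obtain ⟨s, hs, rfl⟩ := exists_eq_prodOneAdd h0 hroot
  refine coeff_one_sub_coeff_two_prodOneAdd_le hs (splits_of_aeval_complex_eq_zero fun z hz => ?_)
  refine htwo z (sub_eq_zero.1 ?_)
  simpa [oddLift, aeval_comp] using hz

section Recurrence

variable {x : ℕ → ℝ} {t lam : ℂ} {u : ℕ → ℂ} {K : ℕ}

theorem re_mul_sum_mul_normSq (hu : ∀ n, u (n + 2) = x n * t * u (n + 1) + u n) (K : ℕ) :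
    t.re * ∑ n ∈ Finset.range K, x n * Complex.normSq (u (n + 1)) =
      (u (K + 1) * star (u K)).re - (u 1 * star (u 0)).re := by
  rw [← Finset.sum_range_sub fun n => (u (n + 1) * star (u n)).re, Finset.mul_sum]
  refine Finset.sum_congr rfl fun n _ => ?_
  simp only [hu n, Complex.star_def, Complex.normSq_apply, Complex.add_re, Complex.add_im,
    Complex.mul_re, Complex.mul_im, Complex.conj_re, Complex.conj_im, Complex.ofReal_re,
    Complex.ofReal_im]
  ring

theorem eq_zero_or_eq_zero_of_recurrence (hx : ∀ n < K, 0 ≤ x n) (hlam : ‖lam‖ = 1)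
    (hu : ∀ n, u (n + 2) = x n * t * u (n + 1) + u n) (huK : u K = lam * u 0)
    (huK' : u (K + 1) = lam * u 1) (ht : t.re ≠ 0) :
    ∀ n < K, x n = 0 ∨ u (n + 1) = 0 := by
  have hends : u (K + 1) * star (u K) = u 1 * star (u 0) := by
    have hunit : lam * star lam = 1 := by simp [Complex.mul_conj, Complex.normSq_eq_norm_sq, hlam]
    rw [huK, huK', star_mul']
    linear_combination (u 1 * star (u 0)) * hunit
  have hsum : ∑ n ∈ Finset.range K, x n * Complex.normSq (u (n + 1)) = 0 := by
    have henergy := re_mul_sum_mul_normSq hu K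
    rw [hends, sub_self] at henergy
    exact (mul_eq_zero.1 henergy).resolve_left ht
  intro n hn
  have hterm := (Finset.sum_eq_zero_iff_of_nonneg fun n hn =>
    mul_nonneg (hx n (Finset.mem_range.1 hn)) (Complex.normSq_nonneg _)).1 hsum n
      (Finset.mem_range.2 hn)
  simpa [Complex.normSq_eq_zero] using hterm

theorem re_eq_zero_of_recurrence (hK : Odd K) (hx : ∀ n < K, 0 ≤ x n)
    (hpos : ∃ n < K, x n ≠ 0) (hlam : ‖lam‖ = 1)
    (hu : ∀ n, u (n + 2) = x n * t * u (n + 1) + u n) (huK : u K = lam * u 0)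
    (huK' : u (K + 1) = lam * u 1) (hne : u 0 ≠ 0 ∨ u 1 ≠ 0) : t.re = 0 := by
  by_contra ht
  have hzero := eq_zero_or_eq_zero_of_recurrence hx hlam hu huK huK' ht
  have hperiod : ∀ n, n ≤ K + 1 → u n = u (n % 2) := by
    intro n
    induction n using Nat.twoStepInduction with
    | zero => exact fun _ => rfl
    | one => exact fun _ => rfl
    | more n ih _ =>
      intro hn
      rw [Nat.add_mod_right, ← ih (by omega), hu]
      rcases hzero n (by omega) with h | h <;> simp [h]
  have hswap : u 1 = lam * u 0 := by rw [← huK, hperiod K (by omega), Nat.odd_iff.1 hK]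
  have hswap' : u 0 = lam * u 1 := by
    rw [← huK', hperiod (K + 1) le_rfl, Nat.even_iff.1 hK.add_one]
  have hu0 : u 0 ≠ 0 := fun h => hne.elim (· h) fun h' => h' (by rw [hswap, h, mul_zero])
  have hu1 : u 1 ≠ 0 := fun h => hu0 (by rw [hswap', h, mul_zero])
  obtain ⟨n, hn, hxn⟩ := hpos
  refine (hzero n hn).elim hxn fun h => ?_
  rw [hperiod (n + 1) (by omega)] at h
  rcases Nat.mod_two_eq_zero_or_one (n + 1) with hmod | hmod
  · exact hu0 (hmod ▸ h)
  · exact hu1 (hmod ▸ h)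

end Recurrence

/-- The product of the transfer matrices `!![x i * t, 1; 1, 0]` of the recurrence
`u (i + 2) = x i * t * u (i + 1) + u i` for `i < n`, latest on the left: it maps the state
`(u 1, u 0)` to `(u (n + 1), u n)`. -/
def transfer {R : Type*} [CommRing R] (x : ℕ → R) (t : R) : ℕ → Matrix (Fin 2) (Fin 2) R
  | 0 => 1
  | n + 1 => !![x n * t, 1; 1, 0] * transfer x t n

section Transfer

variable {R : Type*} [CommRing R] (x : ℕ → R) (t : R)

theorem transfer_zero : transfer x t 0 = 1 := rfl

theorem transfer_succ (n : ℕ) :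
    transfer x t (n + 1) = !![x n * t, 1; 1, 0] * transfer x t n := rfl

theorem transfer_succ_zero (n : ℕ) (j : Fin 2) :
    transfer x t (n + 1) 0 j = x n * t * transfer x t n 0 j + transfer x t n 1 j := by
  simp [transfer_succ, Matrix.mul_apply, Fin.sum_univ_two]

theorem transfer_succ_one (n : ℕ) (j : Fin 2) :
    transfer x t (n + 1) 1 j = transfer x t n 0 j := by
  simp [transfer_succ, Matrix.mul_apply, Fin.sum_univ_two]

theorem det_transfer (n : ℕ) : (transfer x t n).det = (-1) ^ n := by
  induction n with
  | zero => rw [transfer_zero, Matrix.det_one, pow_zero]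
  | succ n ih =>
    rw [transfer_succ, Matrix.det_mul, ih, Matrix.det_fin_two_of, pow_succ']
    ring

theorem map_transfer {S : Type*} [CommRing S] (φ : R →+* S) (n : ℕ) :
    (transfer x t n).map φ = transfer (fun i => φ (x i)) (φ t) n := by
  induction n with
  | zero => simp [transfer_zero]
  | succ n ih =>
    have hstep : !![x n * t, 1; 1, 0].map φ = !![φ (x n) * φ t, 1; 1, 0] := by
      simp [← Matrix.ext_iff]
    rw [transfer_succ, transfer_succ, Matrix.map_mul, ih, hstep]

theorem coeff_transfer_eq_zero {n k : ℕ} {i j : Fin 2} (h : Odd (n + i + j + k)) :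
    (transfer (fun i => C (x i)) X n i j).coeff k = 0 := by
  induction n generalizing i k with
  | zero =>
    rw [transfer_zero, Matrix.one_apply]
    split_ifs with hij
    · subst hij
      rw [coeff_one, if_neg (by grind)]
    · exact coeff_zero k
  | succ n ih =>
    fin_cases i
    · have hlower := ih (i := 1) (k := k) (by grind)
      cases k with
      | zero => simp [transfer_succ_zero, hlower, mul_assoc]
      | succ k =>
        have hupper := ih (i := 0) (k := k) (by grind)
        simp [transfer_succ_zero, hlower, hupper, mul_assoc]
    · have hupper := ih (i := 0) (k := k) (by grind)
      simpa [transfer_succ_one] using hupper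

end Transfer

theorem re_eq_zero_of_transfer_mulVec {x : ℕ → ℝ} {t lam : ℂ} {K : ℕ} (hK : Odd K)
    (hx : ∀ n < K, 0 ≤ x n) (hpos : ∃ n < K, x n ≠ 0) (hlam : ‖lam‖ = 1) {v : Fin 2 → ℂ}
    (hv : v ≠ 0) (h : (transfer (fun i => (x i : ℂ)) t K).mulVec v = lam • v) : t.re = 0 := by
  set s : ℕ → Fin 2 → ℂ := fun n => (transfer (fun i => (x i : ℂ)) t n).mulVec v with hs
  have hs0 : s 0 = v := Matrix.one_mulVec v
  have hs_zero (n : ℕ) : s (n + 1) 0 = x n * t * s n 0 + s n 1 := by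
    simp only [hs, Matrix.mulVec, dotProduct, Fin.sum_univ_two, transfer_succ_zero]
    ring
  have hs_one (n : ℕ) : s (n + 1) 1 = s n 0 := by
    simp only [hs, Matrix.mulVec, dotProduct, Fin.sum_univ_two, transfer_succ_one]
  have hsK (i : Fin 2) : s K i = lam * s 0 i := by rw [hs0]; exact congrFun h i
  refine re_eq_zero_of_recurrence (u := fun n => s n 1) hK hx hpos hlam
    (fun n => by simp only [hs_one, hs_zero]) (hsK 1) (by simpa only [hs_one] using hsK 0) ?_
  by_contra! hzero
  rw [hs_one, hs0] at hzero
  exact hv (funext (Fin.forall_fin_two.2 hzero.symm))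

theorem re_eq_zero_of_trace_transfer {x : ℕ → ℝ} {t lam : ℂ} {K : ℕ} (hK : Odd K)
    (hx : ∀ n < K, 0 ≤ x n) (hpos : ∃ n < K, x n ≠ 0) (hlam : ‖lam‖ = 1)
    (h : (transfer (fun i => (x i : ℂ)) t K).trace = lam - lam⁻¹) : t.re = 0 := by
  set M := transfer (fun i => (x i : ℂ)) t K
  have hlam0 : lam ≠ 0 := norm_ne_zero_iff.1 (hlam ▸ one_ne_zero)
  have hdet : M.det = -1 := by rw [det_transfer, hK.neg_one_pow]
  have hchar : (M - lam • (1 : Matrix (Fin 2) (Fin 2) ℂ)).det = 0 := by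
    rw [Matrix.trace_fin_two] at h
    rw [Matrix.det_fin_two] at hdet ⊢
    simp only [Matrix.sub_apply, Matrix.smul_apply, Matrix.one_apply_eq, Fin.isValue, ne_eq,
      zero_ne_one, one_ne_zero, not_false_eq_true, Matrix.one_apply_ne, smul_eq_mul, mul_one,
      mul_zero, sub_zero]
    linear_combination hdet - lam * h + mul_inv_cancel₀ hlam0
  obtain ⟨v, hv, hv0⟩ := Matrix.exists_mulVec_eq_zero_iff.2 hchar
  refine re_eq_zero_of_transfer_mulVec hK hx hpos hlam hv ?_
  rw [Matrix.sub_mulVec, Matrix.smul_mulVec, Matrix.one_mulVec] at hv0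
  exact sub_eq_zero.1 hv0

section Chain

variable {R : Type*} [CommRing R] (x : ℕ → R)

/-- The sum of `x j₁ ⋯ x jₖ` over the chains `j₁ < ⋯ < jₖ < n` all of whose consecutive
differences, including the last one `n - jₖ`, are odd. -/
def chain : ℕ → ℕ → R
  | 0, _ => 1
  | k + 1, n => ∑ j ∈ Finset.range n, if Odd (n - j) then x j * chain k j else 0

theorem chain_zero (n : ℕ) : chain x 0 n = 1 := by rw [chain]

theorem chain_succ (k n : ℕ) :
    chain x (k + 1) n = ∑ j ∈ Finset.range n, if Odd (n - j) then x j * chain x k j else 0 := rfl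

theorem chain_add_two (k n : ℕ) :
    chain x (k + 1) (n + 2) = x (n + 1) * chain x k (n + 1) + chain x (k + 1) n := by
  rw [chain_succ, chain_succ, Finset.sum_range_succ, Finset.sum_range_succ,
    if_pos (by simp : Odd (n + 2 - (n + 1))), if_neg (by simp : ¬ Odd (n + 2 - n)), add_zero,
    add_comm]
  refine congrArg _ (Finset.sum_congr rfl fun j hj => if_congr ?_ rfl rfl)
  grind

theorem sum_mul_chain (k n : ℕ) :
    ∑ j ∈ Finset.range (n + 1), x j * chain x k j =
      chain x (k + 1) (n + 1) + chain x (k + 1) n := by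
  induction n with
  | zero => simp [chain_succ]
  | succ n ih =>
    rw [Finset.sum_range_succ, ih, chain_add_two]
    ring

theorem coeff_sum_transfer_zero (k n : ℕ) :
    (∑ j, transfer (fun i => C (x i)) X n 0 j).coeff k = chain x k n := by
  induction n using Nat.twoStepInduction generalizing k with
  | zero => cases k <;> simp [transfer_zero, chain, coeff_one]
  | one => rcases k with _ | _ | k <;> simp [transfer, chain, coeff_one]
  | more n ih ih' =>
    have hrec : ∑ j, transfer (fun i => C (x i)) X (n + 2) 0 j =
        C (x (n + 1)) * (X * ∑ j, transfer (fun i => C (x i)) X (n + 1) 0 j) +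
          ∑ j, transfer (fun i => C (x i)) X n 0 j := by
      simp only [transfer_succ_zero _ _ (n + 1), transfer_succ_one, Finset.sum_add_distrib,
        Finset.mul_sum, mul_assoc]
    rw [hrec, coeff_add, ih, coeff_C_mul]
    cases k with
    | zero => simp [chain_zero]
    | succ k => rw [coeff_X_mul, ih', chain_add_two]

/-- The Floquet discriminant of the recurrence `u (i + 2) = x i * t * u (i + 1) + u i` over `K`
steps, as a polynomial in `t`. -/
noncomputable def discriminant (K : ℕ) : R[X] := (transfer (fun i => C (x i)) X K).trace

theorem aeval_discriminant {S : Type*} [CommRing S] [Algebra R S] (K : ℕ) (t : S) :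
    aeval t (discriminant x K) = (transfer (fun i => algebraMap R S (x i)) t K).trace := by
  have hmap := map_transfer (fun i => C (x i)) X (aeval t : R[X] →ₐ[R] S).toRingHom K
  simp only [AlgHom.toRingHom_eq_coe, RingHom.coe_coe, aeval_X, aeval_C] at hmap
  rw [← hmap, discriminant]
  exact AddMonoidHom.map_trace (aeval t : R[X] →ₐ[R] S) _

variable {K k : ℕ}

theorem coeff_discriminant_of_even (hK : Odd K) (hk : Even k) :
    (discriminant x K).coeff k = 0 := by
  rw [discriminant, Matrix.trace_fin_two, coeff_add, coeff_transfer_eq_zero x (by grind),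
    coeff_transfer_eq_zero x (by grind), add_zero]

theorem coeff_discriminant_succ (hK : Odd K) (hk : Even k) :
    (discriminant x K).coeff (k + 1) = ∑ j ∈ Finset.range K, x j * chain x k j := by
  obtain ⟨n, rfl⟩ := Nat.exists_eq_add_of_le' hK.pos
  have hupper : (transfer (fun i => C (x i)) X (n + 1) 0 1).coeff (k + 1) = 0 :=
    coeff_transfer_eq_zero x (by grind)
  have hlower : (transfer (fun i => C (x i)) X (n + 1) 1 0).coeff (k + 1) = 0 :=
    coeff_transfer_eq_zero x (by grind)
  rw [sum_mul_chain, ← coeff_sum_transfer_zero, ← coeff_sum_transfer_zero]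
  simp only [← transfer_succ_one _ _ n, discriminant, Matrix.trace_fin_two, Fin.sum_univ_two,
    coeff_add, hupper, hlower, add_zero, zero_add]

end Chain

theorem exists_eq_X_mul_expand_two {R : Type*} [CommSemiring R] {p : R[X]}
    (hp : ∀ k, Even k → p.coeff k = 0) :
    ∃ H : R[X], (∀ j, H.coeff j = p.coeff (2 * j + 1)) ∧ p = X * expand R 2 H := by
  refine ⟨contract 2 (divX p), fun j => ?_, ?_⟩
  · rw [coeff_contract two_ne_zero, coeff_divX, mul_comm]
  · ext k
    cases k with
    | zero => simpa using hp 0 Even.zero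
    | succ k =>
      rw [coeff_X_mul, coeff_expand two_pos]
      split_ifs with hk
      · rw [coeff_contract two_ne_zero, coeff_divX, Nat.div_mul_cancel hk]
      · exact hp _ (Nat.even_add_one.2 (mt even_iff_two_dvd.1 hk))

theorem sum_chain_two_sub_sum_chain_four_le {x : ℕ → ℝ} {K : ℕ} (hK : Odd K)
    (hx : ∀ n < K, 0 ≤ x n) (hsum : ∑ j ∈ Finset.range K, x j = 1) :
    ∑ j ∈ Finset.range K, x j * chain x 2 j - 27 / 2 * ∑ j ∈ Finset.range K, x j * chain x 4 j
      ≤ 1 / 27 := by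
  obtain ⟨H, hcoeff, hH⟩ :=
    exists_eq_X_mul_expand_two fun k => coeff_discriminant_of_even x hK (k := k)
  have hpos : ∃ n < K, x n ≠ 0 := by
    simpa only [Finset.mem_range] using
      Finset.exists_ne_zero_of_sum_ne_zero (hsum.trans_ne one_ne_zero)
  have hre (t lam : ℂ) (hlam : ‖lam‖ = 1) (h : t * aeval (t ^ 2) H = lam - lam⁻¹) : t.re = 0 := by
    refine re_eq_zero_of_trace_transfer hK hx hpos hlam ?_
    have htrace := aeval_discriminant x K t
    rw [hH, map_mul, aeval_X, expand_aeval, h] at htrace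
    exact htrace.symm
  have hcoeff_chain (k : ℕ) : ∑ j ∈ Finset.range K, x j * chain x (2 * k) j = H.coeff k := by
    rw [hcoeff, coeff_discriminant_succ x hK (even_two_mul k)]
  rw [hcoeff_chain 1, hcoeff_chain 2]
  refine coeff_one_sub_coeff_two_le ?_ (fun w hw => ?_) fun z hz => ?_
  · simpa only [← hcoeff_chain, mul_zero, chain_zero, mul_one] using hsum
  · obtain ⟨t, rfl⟩ := IsAlgClosed.exists_pow_nat_eq w two_pos
    have ht : t.re = 0 := hre t 1 norm_one (by simp [hw])
    simpa [pow_two, ht] using mul_self_nonneg t.im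
  · have ht : (Complex.I * z).re = 0 := by
      refine hre _ Complex.I Complex.norm_I ?_
      rw [mul_pow, Complex.I_sq, neg_one_mul, mul_assoc, hz, Complex.inv_I]
      ring
    simpa using ht

theorem chain_succ_fin {R : Type*} [CommRing R] {K : ℕ} (x : ℕ → R) (k : ℕ) (i : Fin K) :
    chain x (k + 1) i =
      ∑ j : Fin K, (if j < i ∧ Odd ((i : ℕ) - j) then 1 else 0) * (x j * chain x k j) := by
  simp only [chain_succ, Fin.lt_def, boole_mul]
  rw [Fin.sum_univ_eq_sum_range (fun j : ℕ =>
    if j < (i : ℕ) ∧ Odd ((i : ℕ) - j) then x j * chain x k j else 0) K,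
    ← Finset.sum_subset (Finset.range_subset_range.2 i.2.le) fun j _ hj =>
      if_neg fun h => hj (Finset.mem_range.2 h.1)]
  refine Finset.sum_congr rfl fun j hj => if_congr ?_ rfl rfl
  rw [and_iff_right (Finset.mem_range.1 hj)]

-- Chains are built from their largest index down, hence the reversal of the index tuples.
theorem f₃_eq_sum_chain (K : ℕ) (x : ℕ → ℝ) :
    f₃ K (fun i => x i) = ∑ j ∈ Finset.range K, x j * chain x 2 j := by
  let reverse : Fin K × Fin K × Fin K ≃ Fin K × Fin K × Fin K :=
    ⟨fun (a, b, c) => (c, b, a), fun (a, b, c) => (c, b, a), fun _ => rfl, fun _ => rfl⟩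
  rw [← Fin.sum_univ_eq_sum_range (fun j => x j * chain x 2 j) K, f₃, triples, Finset.sum_filter,
    ← reverse.sum_comp]
  simp only [Fintype.sum_prod_type, chain_succ_fin, chain_zero, Finset.mul_sum, reverse,
    Equiv.coe_fn_mk]
  refine Finset.sum_congr rfl fun a _ => Finset.sum_congr rfl fun b _ =>
    Finset.sum_congr rfl fun c _ => ?_
  simp only [boole_mul, mul_ite, mul_zero, ← ite_and]
  exact if_congr (by tauto) (by ring) rfl

theorem f₅_eq_sum_chain (K : ℕ) (x : ℕ → ℝ) :
    f₅ K (fun i => x i) = ∑ j ∈ Finset.range K, x j * chain x 4 j := by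
  let reverse : Fin K × Fin K × Fin K × Fin K × Fin K ≃ Fin K × Fin K × Fin K × Fin K × Fin K :=
    ⟨fun (a, b, c, d, e) => (e, d, c, b, a), fun (a, b, c, d, e) => (e, d, c, b, a),
      fun _ => rfl, fun _ => rfl⟩
  rw [← Fin.sum_univ_eq_sum_range (fun j => x j * chain x 4 j) K, f₅, quintuples,
    Finset.sum_filter, ← reverse.sum_comp]
  simp only [Fintype.sum_prod_type, chain_succ_fin, chain_zero, Finset.mul_sum, reverse,
    Equiv.coe_fn_mk]
  refine Finset.sum_congr rfl fun a _ => Finset.sum_congr rfl fun b _ =>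
    Finset.sum_congr rfl fun c _ => Finset.sum_congr rfl fun d _ =>
    Finset.sum_congr rfl fun e _ => ?_
  simp only [boole_mul, mul_ite, mul_zero, ← ite_and]
  exact if_congr (by tauto) (by ring) rfl

theorem f₅_nonneg {K : ℕ} {x : Fin K → ℝ} (hx : ∀ i, 0 ≤ x i) : 0 ≤ f₅ K x := by
  refine Finset.sum_nonneg fun i _ => ?_
  have h₀ := hx i.1
  have h₁ := hx i.2.1
  have h₂ := hx i.2.2.1
  have h₃ := hx i.2.2.2.1
  have h₄ := hx i.2.2.2.2
  positivity

theorem f₃_sub_f₅_le {K : ℕ} (hK : Odd K) {x : Fin K → ℝ} (hx : x ∈ stdSimplex ℝ (Fin K)) :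
    f₃ K x - 27 / 2 * f₅ K x ≤ 1 / 27 := by
  obtain ⟨y, rfl⟩ : ∃ y : ℕ → ℝ, x = fun i : Fin K => y i :=
    ⟨Function.extend Fin.val x 0, (Function.extend_comp Fin.val_injective x 0).symm⟩
  rw [f₃_eq_sum_chain, f₅_eq_sum_chain]
  refine sum_chain_two_sub_sum_chain_four_le hK (fun n hn => hx.1 ⟨n, hn⟩) ?_
  rw [← Fin.sum_univ_eq_sum_range y K, hx.2]

theorem f₃_sub_mul_f₅_le {K : ℕ} (hK : Odd K) {x : Fin K → ℝ} (hx : x ∈ stdSimplex ℝ (Fin K))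
    {c : ℝ} (hc : 27 / 2 ≤ c) : f₃ K x - c * f₅ K x ≤ 1 / 27 := by
  have hmul := mul_le_mul_of_nonneg_right hc (f₅_nonneg hx.1)
  linarith [f₃_sub_f₅_le hK hx]

/-- The maximizer: the point of the simplex that is uniform on the first three coordinates. -/
noncomputable def uniformThree (K : ℕ) (i : Fin K) : ℝ := if (i : ℕ) < 3 then 1 / 3 else 0

theorem uniformThree_mem_stdSimplex {K : ℕ} (hK : 3 ≤ K) :
    uniformThree K ∈ stdSimplex ℝ (Fin K) := by
  refine ⟨fun i => ?_, ?_⟩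
  · unfold uniformThree
    split_ifs <;> norm_num
  · have hsupport := Finset.sum_subset (Finset.range_subset_range.2 hK) fun j _ hj =>
      (if_neg (mt Finset.mem_range.2 hj) : (if j < 3 then (1 / 3 : ℝ) else 0) = 0)
    simp only [uniformThree, Fin.sum_univ_eq_sum_range (fun i => if i < 3 then (1 / 3 : ℝ) else 0),
      ← hsupport]
    norm_num [Finset.sum_range_succ]

theorem f₃_uniformThree {K : ℕ} (hK : 3 ≤ K) : f₃ K (uniformThree K) = 1 / 27 := by
  rw [f₃, Finset.sum_eq_single ((⟨0, by omega⟩, ⟨1, by omega⟩, ⟨2, by omega⟩) :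
    Fin K × Fin K × Fin K)]
  · norm_num [uniformThree]
  · rintro ⟨a, b, c⟩ hmem hne
    simp only [triples, Finset.mem_filter, Finset.mem_univ, true_and, Fin.lt_def] at hmem
    simp only [ne_eq, Prod.mk.injEq, Fin.ext_iff] at hne
    rw [show uniformThree K c = 0 from if_neg (by omega), mul_zero]
  · intro hmem
    exact absurd (by simp [triples]) hmem

theorem f₅_uniformThree (K : ℕ) : f₅ K (uniformThree K) = 0 := by
  refine Finset.sum_eq_zero ?_
  rintro ⟨a, b, c, d, e⟩ hmem
  simp only [quintuples, Finset.mem_filter, Finset.mem_univ, true_and, Fin.lt_def] at hmem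
  rw [show uniformThree K e = 0 from if_neg (by omega), mul_zero]

end Herman

theorem mainTheorem3_general (K : ℕ) (hK : 3 ≤ K) (hodd : Odd K) {c : ℝ} (hc : 27 / 2 ≤ c) :
    IsGreatest ((fun x => Herman.f₃ K x - c * Herman.f₅ K x) '' stdSimplex ℝ (Fin K)) (1 / 27) := by
  refine ⟨⟨_, Herman.uniformThree_mem_stdSimplex hK, ?_⟩, ?_⟩
  · simp only [Herman.f₃_uniformThree hK, Herman.f₅_uniformThree, mul_zero, sub_zero]
  · rintro _ ⟨x, hx, rfl⟩
    exact Herman.f₃_sub_mul_f₅_le hodd hx hc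

theorem mainTheorem3 (K : ℕ) (hK : 3 ≤ K) (hodd : Odd K) :
    IsGreatest (Herman.f K '' stdSimplex ℝ (Fin K)) (1 / 27) :=
  mainTheorem3_general K hK hodd (by norm_num)
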